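/- A $3$-star $\{x;a,b,c\}$ is a copy of the complete bipartite graph $K_{1,3}$, with centre $x$ and three distinct leaves $a,b,c\neq x$. A $3$-star system of order $n>1$ is a set of $3$-stars on an $n$-element vertex set whose edge sets partition the edge set of the complete graph $K_n$. It is $k$-colourable if its vertices can be partitioned into $k$ (possibly empty) colour classes so that no $3$-star of the system has all four of its vertices in one class, and $k$-chromatic if it is $k$-colourable but not $(k-1)$-colourable. An integer $n>1$ is called admissible if a $3$-star system of order $n$ exists. An integer $n$ is admissible if and only if $n\equiv 0$ or $1 \pmod 3$ and $n\geq 6$. Moreover, for every integer $k\geq 2$ there exists an integer $n_k$ such that for every admissible $n\geq n_k$ there exists a $k$-chromatic $3$-star system of order $n$. -/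

import Mathlib

/-- An `e`-star `{x; A}` on the vertex set `V`: a copy of `K_{1,e}` with centre `x` and set of
leaves `A`, where `|A| = e` and `x ∉ A`. -/
structure GraphStar (e : ℕ) (V : Type*) where
  centre : V
  leaves : Finset V
  card_leaves : leaves.card = e
  centre_notMem : centre ∉ leaves

namespace GraphStar

variable {e : ℕ} {V : Type*}

/-- The edges `{x, a}`, `a ∈ A`, of the star `{x; A}`. -/
def edges (S : GraphStar e V) : Set (Sym2 V) :=
  {p | ∃ a ∈ S.leaves, p = s(S.centre, a)}

/-- The vertices of the star: its centre and its leaves. -/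
def vertices (S : GraphStar e V) : Set V :=
  {v | v = S.centre ∨ v ∈ S.leaves}

/-- A star is monochromatic if all its vertices have the same colour. -/
def IsMonochromatic {C : Type*} (f : V → C) (S : GraphStar e V) : Prop :=
  ∃ c, ∀ v ∈ S.vertices, f v = c

end GraphStar

/-- An `e`-star system (for `e ≥ 1`) on the vertex set `V`: a set of `e`-stars whose edge sets
partition the edge set of the complete graph on `V`. -/
structure StarSystem (e : ℕ) (V : Type*) where
  blocks : Set (GraphStar e V)
  existsUnique_block : ∀ p ∈ (⊤ : SimpleGraph V).edgeSet, ∃! S, S ∈ blocks ∧ p ∈ S.edges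

namespace StarSystem

variable {e : ℕ} {V : Type*}

/-- `k`-colourable: the vertices can be put into `k` colour classes (the fibres of `f`) such that
no star of the system is monochromatic. -/
def IsColourable (B : StarSystem e V) (k : ℕ) : Prop :=
  ∃ f : V → Fin k, ∀ S ∈ B.blocks, ¬ S.IsMonochromatic f

/-- `k`-chromatic (for `k ≥ 1`): `k`-colourable but not `(k - 1)`-colourable. -/
def IsChromatic (B : StarSystem e V) (k : ℕ) : Prop :=
  B.IsColourable k ∧ ¬ B.IsColourable (k - 1)

end StarSystem

/-- `n` is admissible for `e`: `n > 1` and there exists an `e`-star system of order `n`. -/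
def IsAdmissibleOrder (e n : ℕ) : Prop :=
  1 < n ∧ Nonempty (StarSystem e (Fin n))

/-! If the order of `A` is divisible by 3, systems on `A` and `B` glue: partition `A` into triples
and make each vertex of `B` the centre of a star on each triple. Colourings of the parts that use
the same colours stay proper if no triple is monochromatic; such a partition exists when no colour
fills more than two thirds of `A`. The chromatic number grows by induction. Let `X` have no proper
`j`-colouring, so that a proper `(j+1)`-colouring uses every colour on each copy of `X`. Gluing
recoloured copies gives `W` with a colouring `f` in `j+2` colours such that each proper
`(j+1)`-colouring is constant on some triple not constant under `f`. Gluing on one more copy of `X`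
per such triple, with that triple in the partition, kills all these colourings: some vertex of the
copy has the colour of the triple. Systems of orders 6 and 9, and a single vertex, then fill in all
large orders. Edge counting and the exclusion of order 4 give necessity. -/

open Finset

/-! ### Star systems as relations -/

/-- A `3`-star system described by the relation `star v T`: the star `{v; T}` is a block. -/
structure TripleSystem (V : Type*) where
  star : V → Finset V → Prop
  card_eq : ∀ {v T}, star v T → T.card = 3
  notMem : ∀ {v T}, star v T → v ∉ T
  exists_star : ∀ {u v}, u ≠ v → ∃ T, (star u T ∧ v ∈ T) ∨ (star v T ∧ u ∈ T)
  eq_of_mem : ∀ {u v T T'}, star u T → star u T' → v ∈ T → v ∈ T' → T = T'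
  asymm : ∀ {u v T T'}, star u T → v ∈ T → star v T' → u ∉ T'

namespace TripleSystem

variable {V A B C : Type*}

/-- `g` is a proper colouring: no star is monochromatic. -/
def Proper (S : TripleSystem V) (g : V → C) : Prop :=
  ∀ v T, S.star v T → ∃ w ∈ T, g w ≠ g v

/-- The star system given by a triple system. -/
def toStarSystem (S : TripleSystem V) : StarSystem 3 V where
  blocks := {X | S.star X.centre X.leaves}
  existsUnique_block := by
    intro p hp
    induction p with | _ u v
    have huv : u ≠ v := by simpa using hp
    have key : ∀ {u v : V} {T : Finset V}, S.star u T → v ∈ T →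
        ∃! X : GraphStar 3 V, X ∈ {X : GraphStar 3 V | S.star X.centre X.leaves} ∧
          s(u, v) ∈ X.edges := by
      intro u v T hT hv
      refine ⟨⟨u, T, S.card_eq hT, S.notMem hT⟩, ⟨hT, v, hv, rfl⟩, ?_⟩
      rintro ⟨x, L, h3, hx⟩ ⟨hL, a, ha, hpa⟩
      simp only [Sym2.eq_iff] at hpa ha
      rcases hpa with ⟨rfl, rfl⟩ | ⟨rfl, rfl⟩
      · obtain rfl := S.eq_of_mem hL hT ha hv
        rfl
      · exact absurd ha (S.asymm hT hv hL)
    obtain ⟨T, ⟨hT, hv⟩ | ⟨hT, hu⟩⟩ := S.exists_star huv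
    · exact key hT hv
    · rw [Sym2.eq_swap]
      exact key hT hu

theorem isColourable_toStarSystem_iff (S : TripleSystem V) (k : ℕ) :
    S.toStarSystem.IsColourable k ↔ ∃ g : V → Fin k, S.Proper g := by
  refine exists_congr fun g => ⟨fun h v T hT => ?_, fun h X hX hm => ?_⟩
  · by_contra! hc
    refine h ⟨v, T, S.card_eq hT, S.notMem hT⟩ hT ⟨g v, ?_⟩
    rintro w (rfl | hw)
    · rfl
    · exact hc w hw
  · obtain ⟨c, hc⟩ := hm
    obtain ⟨w, hw, hne⟩ := h _ _ hX
    exact hne ((hc w (Or.inr hw)).trans (hc _ (Or.inl rfl)).symm)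

/-- Transport of a triple system along an equivalence. -/
def mapEquiv (S : TripleSystem A) (e : A ≃ B) : TripleSystem B where
  star v T := S.star (e.symm v) (T.map e.symm.toEmbedding)
  card_eq h := by simpa using S.card_eq h
  notMem h := by simpa using S.notMem h
  exists_star {u v} h := by
    obtain ⟨T, hT⟩ := S.exists_star (e.symm.injective.ne h)
    refine ⟨T.map e.toEmbedding, ?_⟩
    have : (T.map e.toEmbedding).map e.symm.toEmbedding = T := by
      ext; simp
    simpa [this] using hT
  eq_of_mem {u v T T'} h h' hv hv' := by
    have := S.eq_of_mem (v := e.symm v) h h' (by simpa using hv) (by simpa using hv')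
    exact Finset.map_injective _ this
  asymm {u v T T'} h hv h' hu :=
    S.asymm (v := e.symm v) h (by simpa using hv) h' (by simpa using hu)

theorem Proper.mapEquiv {S : TripleSystem A} {g : A → C} (h : S.Proper g) (e : A ≃ B) :
    (S.mapEquiv e).Proper (g ∘ e.symm) := by
  intro v T hT
  obtain ⟨w, hw, hne⟩ := h _ _ hT
  simp only [mem_map] at hw
  obtain ⟨x, hx, rfl⟩ := hw
  exact ⟨x, hx, hne⟩

theorem Proper.of_mapEquiv {S : TripleSystem A} {e : A ≃ B} {g : B → C}
    (h : (S.mapEquiv e).Proper g) : S.Proper (g ∘ e) := by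
  intro v T hT
  have : (T.map e.toEmbedding).map e.symm.toEmbedding = T := by
    ext; simp
  obtain ⟨w, hw, hne⟩ := h (e v) (T.map e.toEmbedding)
    (by simpa [TripleSystem.mapEquiv, this] using hT)
  simp only [mem_map] at hw
  obtain ⟨x, hx, rfl⟩ := hw
  exact ⟨x, hx, hne⟩

theorem Proper.comp_injective {D : Type*} {S : TripleSystem A} {g : A → C} (h : S.Proper g)
    {i : C → D} (hi : Function.Injective i) : S.Proper (i ∘ g) := fun v T hT => by
  obtain ⟨w, hw, hne⟩ := h v T hT
  exact ⟨w, hw, hi.ne hne⟩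

theorem Proper.of_comp {D : Type*} {S : TripleSystem A} {g : A → C} {i : C → D}
    (h : S.Proper (i ∘ g)) : S.Proper g := fun v T hT => by
  obtain ⟨w, hw, hne⟩ := h v T hT
  exact ⟨w, hw, fun he => hne (congrArg i he)⟩

end TripleSystem

/-! ### Partitions into non-monochromatic triples -/

/-- `Q` is a partition of the finite set `N` into triples. -/
structure IsTriplePartition {A : Type*} (N : Finset A) (Q : Set (Finset A)) : Prop where
  card_eq : ∀ {T}, T ∈ Q → T.card = 3
  subset : ∀ {T}, T ∈ Q → T ⊆ N
  exists_mem : ∀ {x}, x ∈ N → ∃ T ∈ Q, x ∈ T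
  eq_of_mem : ∀ {x T T'}, T ∈ Q → T' ∈ Q → x ∈ T → x ∈ T' → T = T'

/-- `T` is not monochromatic under `f`. -/
def NonMono {A C : Type*} (f : A → C) (T : Finset A) : Prop :=
  ∃ x ∈ T, ∃ y ∈ T, f x ≠ f y

theorem NonMono.exists_ne {A C : Type*} {f : A → C} {T : Finset A} (h : NonMono f T) (c : C) :
    ∃ x ∈ T, f x ≠ c := by
  obtain ⟨x, hx, y, hy, hne⟩ := h
  by_cases hc : f x = c
  · exact ⟨y, hy, fun h => hne (hc.trans h.symm)⟩
  · exact ⟨x, hx, hc⟩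

/-- Sort `N` by colour and group positions `i`, `i + m`, `i + 2m`. A monochromatic group would force
`2m + 1` consecutive elements of one colour, more than two thirds of `3m`. -/
theorem exists_nonMono_triplePartition {A C : Type*} [LinearOrder C] (f : A → C) (N : Finset A)
    (h3 : 3 ∣ N.card) (hN : ∀ c, 3 * (N.filter (f · = c)).card ≤ 2 * N.card) :
    ∃ Q, IsTriplePartition N Q ∧ ∀ T ∈ Q, NonMono f T := by
  classical
  obtain ⟨m, hm⟩ := h3
  obtain ⟨e, he⟩ : ∃ e : Fin (3 * m) ≃ N, Monotone fun i => f (e i) := by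
    let e₀ : Fin (3 * m) ≃ N := (finCongr hm.symm).trans N.equivFin.symm
    exact ⟨(Tuple.sort fun i => f (e₀ i)).trans e₀, Tuple.monotone_sort fun i => f (e₀ i)⟩
  let p : Fin m → Fin 3 → A := fun i j => e ⟨i + j * m, by
    have := i.2; have := j.2
    have : (j : ℕ) * m ≤ 2 * m := Nat.mul_le_mul_right m (by omega)
    omega⟩
  have hp : ∀ {i j i' j'}, p i j = p i' j' → i = i' ∧ j = j' := by
    intro i j i' j' h
    have h := e.injective (Subtype.ext h)
    simp only [Fin.mk.injEq] at h
    have hi := i.2; have hi' := i'.2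
    have h1 : (i : ℕ) = i' := by
      have := congrArg (· % m) h
      simpa [Nat.mod_eq_of_lt hi, Nat.mod_eq_of_lt hi'] using this
    refine ⟨Fin.ext h1, Fin.ext ?_⟩
    rw [h1] at h
    exact Nat.eq_of_mul_eq_mul_right (by omega) (by omega : (j : ℕ) * m = j' * m)
  let T : Fin m → Finset A := fun i => univ.image (p i)
  have hT : ∀ i, (T i).card = 3 := fun i => by
    rw [card_image_of_injective _ fun j j' h => (hp h).2]; rfl
  refine ⟨Set.range T, ⟨?_, ?_, ?_, ?_⟩, ?_⟩
  · rintro _ ⟨i, rfl⟩; exact hT i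
  · rintro _ ⟨i, rfl⟩ x hx
    obtain ⟨j, -, rfl⟩ := mem_image.1 hx
    exact (e _).2
  · intro x hx
    set q := e.symm ⟨x, hx⟩ with hq
    have hmpos : 0 < m := by have := q.2; omega
    refine ⟨_, ⟨⟨q % m, Nat.mod_lt _ hmpos⟩, rfl⟩, mem_image.2
      ⟨⟨q / m, Nat.div_lt_of_lt_mul (by have := q.2; omega)⟩, mem_univ _, ?_⟩⟩
    have : (⟨(q : ℕ) % m + q / m * m, by rw [Nat.mod_add_div']; exact q.2⟩ : Fin (3 * m)) = q :=
      Fin.ext (Nat.mod_add_div' _ _)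
    simp only [p, this]
    simp [hq]
  · rintro x _ _ ⟨i, rfl⟩ ⟨i', rfl⟩ hx hx'
    obtain ⟨j, -, rfl⟩ := mem_image.1 hx
    obtain ⟨j', -, h⟩ := mem_image.1 hx'
    rw [(hp h).1]
  · rintro _ ⟨i, rfl⟩
    refine ⟨p i 0, mem_image_of_mem _ (mem_univ _), p i 2, mem_image_of_mem _ (mem_univ _), ?_⟩
    intro hc
    have hi := i.2
    have hsub : ((Finset.range (2 * m + 1)).attach.image fun t =>
        ((e ⟨i + t.1, by have := Finset.mem_range.1 t.2; omega⟩ : N) : A)) ⊆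
        N.filter (f · = f (p i 0)) := by
      intro x hx
      obtain ⟨t, -, rfl⟩ := mem_image.1 hx
      have ht := Finset.mem_range.1 t.2
      refine mem_filter.2 ⟨(e _).2, le_antisymm ?_ ?_⟩
      · rw [hc]; apply he; simp [Fin.le_def]; omega
      · apply he; simp [Fin.le_def]
    have h1 := card_le_card hsub
    rw [card_image_of_injective _ (fun t t' h => by
      have h := e.injective (Subtype.ext h)
      simp only [Fin.mk.injEq] at h
      exact Subtype.ext (by omega))] at h1
    have := hN (f (p i 0))
    simp at h1
    omega

/-- Set `T` aside and partition the rest; the slack 6 pays for the drop of `2 * N.card` when three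
elements leave. -/
theorem exists_nonMono_triplePartition_mem {A C : Type*} [LinearOrder C] (f : A → C)
    (N T : Finset A) (h3 : 3 ∣ N.card)
    (hN : ∀ c, 3 * (N.filter (f · = c)).card + 6 ≤ 2 * N.card) (hT : T.card = 3) (hTN : T ⊆ N)
    (hf : NonMono f T) :
    ∃ Q, IsTriplePartition N Q ∧ (∀ T ∈ Q, NonMono f T) ∧ T ∈ Q := by
  classical
  have hc := card_sdiff_add_card_eq_card hTN
  obtain ⟨Q, hQ, hQf⟩ := exists_nonMono_triplePartition f (N \ T) (by omega) (fun c => by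
    have := card_le_card (filter_subset_filter (f · = c) (sdiff_subset (s := N) (t := T)))
    have := hN c
    omega)
  have hdis : ∀ {T' x}, T' ∈ Q → x ∈ T' → x ∉ T := fun h hx =>
    (mem_sdiff.1 (hQ.subset h hx)).2
  refine ⟨insert T Q, ⟨?_, ?_, ?_, ?_⟩, ?_, Set.mem_insert _ _⟩
  · rintro _ (rfl | h)
    exacts [hT, hQ.card_eq h]
  · rintro _ (rfl | h)
    exacts [hTN, (hQ.subset h).trans sdiff_subset]
  · intro x hx
    by_cases hxT : x ∈ T
    · exact ⟨T, Set.mem_insert _ _, hxT⟩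
    · obtain ⟨T', h, hx'⟩ := hQ.exists_mem (mem_sdiff.2 ⟨hx, hxT⟩)
      exact ⟨T', Set.mem_insert_of_mem _ h, hx'⟩
  · rintro x _ _ (rfl | h) (rfl | h') hx hx'
    · rfl
    · exact absurd hx (hdis h' hx')
    · exact absurd hx' (hdis h hx)
    · exact hQ.eq_of_mem h h' hx hx'
  · rintro _ (rfl | h)
    exacts [hf, hQf _ h]

/-! ### Gluing -/

namespace TripleSystem

variable {A B C : Type*}

/-- The system on `A ⊕ B` in which every vertex of `B` is the centre of stars with leaf sets
the triples of a partition `Q` of `A`. -/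
def glue [Fintype A] (S : TripleSystem A) (R : TripleSystem B) {Q : Set (Finset A)}
    (hQ : IsTriplePartition univ Q) : TripleSystem (A ⊕ B) where
  star v T := match v with
    | .inl a => ∃ T₀, S.star a T₀ ∧ T = T₀.map .inl
    | .inr b => (∃ T₀, R.star b T₀ ∧ T = T₀.map .inr) ∨ ∃ T₀ ∈ Q, T = T₀.map .inl
  card_eq {v T} h := by
    rcases v with a | b
    · obtain ⟨T₀, h, rfl⟩ := h
      simpa using S.card_eq h
    · obtain ⟨T₀, h, rfl⟩ | ⟨T₀, h, rfl⟩ := h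
      · simpa using R.card_eq h
      · simpa using hQ.card_eq h
  notMem {v T} h := by
    rcases v with a | b
    · obtain ⟨T₀, h, rfl⟩ := h
      simpa using S.notMem h
    · obtain ⟨T₀, h, rfl⟩ | ⟨T₀, h, rfl⟩ := h
      · simpa using R.notMem h
      · simp
  exists_star {u v} h := by
    rcases u with a | b <;> rcases v with a' | b'
    · obtain ⟨T, ⟨h, hm⟩ | ⟨h, hm⟩⟩ := S.exists_star (u := a) (v := a') (by simpa using h)
      · exact ⟨_, .inl ⟨⟨T, h, rfl⟩, by simpa using hm⟩⟩
      · exact ⟨_, .inr ⟨⟨T, h, rfl⟩, by simpa using hm⟩⟩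
    · obtain ⟨T, h, hm⟩ := hQ.exists_mem (mem_univ a)
      exact ⟨_, .inr ⟨.inr ⟨T, h, rfl⟩, by simpa using hm⟩⟩
    · obtain ⟨T, h, hm⟩ := hQ.exists_mem (mem_univ a')
      exact ⟨_, .inl ⟨.inr ⟨T, h, rfl⟩, by simpa using hm⟩⟩
    · obtain ⟨T, ⟨h, hm⟩ | ⟨h, hm⟩⟩ := R.exists_star (u := b) (v := b') (by simpa using h)
      · exact ⟨_, .inl ⟨.inl ⟨T, h, rfl⟩, by simpa using hm⟩⟩
      · exact ⟨_, .inr ⟨.inl ⟨T, h, rfl⟩, by simpa using hm⟩⟩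
  eq_of_mem {u v T T'} h h' hv hv' := by
    rcases u with a | b
    · obtain ⟨T₀, h, rfl⟩ := h
      obtain ⟨T₁, h', rfl⟩ := h'
      rcases v with v | v <;> simp at hv hv'
      rw [S.eq_of_mem h h' hv hv']
    · rcases v with v | v <;> obtain ⟨T₀, h, rfl⟩ | ⟨T₀, h, rfl⟩ := h <;>
        obtain ⟨T₁, h', rfl⟩ | ⟨T₁, h', rfl⟩ := h' <;> simp at hv hv'
      · rw [hQ.eq_of_mem h h' hv hv']
      · rw [R.eq_of_mem h h' hv hv']
  asymm {u v T T'} h hv h' hu := by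
    rcases u with a | b <;> rcases v with a' | b'
    · obtain ⟨T₀, h, rfl⟩ := h
      obtain ⟨T₁, h', rfl⟩ := h'
      exact S.asymm h (by simpa using hv) h' (by simpa using hu)
    · obtain ⟨T₀, h, rfl⟩ := h
      simp at hv
    · obtain ⟨T₁, h', rfl⟩ := h'
      simp at hu
    · obtain ⟨T₀, h, rfl⟩ | ⟨T₀, h, rfl⟩ := h <;>
        obtain ⟨T₁, h', rfl⟩ | ⟨T₁, h', rfl⟩ := h' <;> simp at hv hu
      exact R.asymm h hv h' hu

section glue

variable [Fintype A] {S : TripleSystem A} {R : TripleSystem B} {Q : Set (Finset A)}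
  {hQ : IsTriplePartition univ Q}

theorem Proper.glue {f : A → C} {h : B → C} (hf : S.Proper f) (hh : R.Proper h)
    (hQf : ∀ T ∈ Q, NonMono f T) : (S.glue R hQ).Proper (Sum.elim f h) := by
  rintro (a | b) T hT
  · obtain ⟨T₀, hT, rfl⟩ := hT
    simpa using hf a T₀ hT
  · obtain ⟨T₀, hT, rfl⟩ | ⟨T₀, hT, rfl⟩ := hT
    · simpa using hh b T₀ hT
    · simpa using (hQf T₀ hT).exists_ne (h b)

theorem Proper.glue_left {g : A ⊕ B → C} (h : (S.glue R hQ).Proper g) :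
    S.Proper (g ∘ Sum.inl) := fun a T hT => by
  simpa using h (.inl a) (T.map .inl) ⟨T, hT, rfl⟩

theorem Proper.glue_right {g : A ⊕ B → C} (h : (S.glue R hQ).Proper g) :
    R.Proper (g ∘ Sum.inr) := fun b T hT => by
  simpa using h (.inr b) (T.map .inr) (.inl ⟨T, hT, rfl⟩)

theorem Proper.glue_mem {g : A ⊕ B → C} (h : (S.glue R hQ).Proper g) {T : Finset A} (hT : T ∈ Q)
    (b : B) : ∃ x ∈ T, g (.inl x) ≠ g (.inr b) := by
  simpa using h (.inr b) (T.map .inl) (.inr ⟨T, hT, rfl⟩)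

end glue

/-- The system on one vertex, without stars. -/
def single : TripleSystem Unit where
  star _ _ := False
  card_eq h := h.elim
  notMem h := h.elim
  exists_star h := (h rfl).elim
  eq_of_mem h := h.elim
  asymm h := h.elim

theorem proper_single (g : Unit → C) : single.Proper g := fun _ _ h => h.elim

/-- The system whose stars with centre `v` have the leaf sets in `L v`. -/
def ofFinsets (L : A → Finset (Finset A)) (h₁ : ∀ v, ∀ T ∈ L v, T.card = 3 ∧ v ∉ T)
    (h₂ : ∀ u v, u ≠ v → (∃ T ∈ L u, v ∈ T) ∨ ∃ T ∈ L v, u ∈ T)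
    (h₃ : ∀ u, ∀ T ∈ L u, ∀ v ∈ T, (∀ T' ∈ L u, v ∈ T' → T = T') ∧ ∀ T' ∈ L v, u ∉ T') :
    TripleSystem A where
  star v T := T ∈ L v
  card_eq h := (h₁ _ _ h).1
  notMem h := (h₁ _ _ h).2
  exists_star {u v} h := by
    obtain ⟨T, hT, hm⟩ | ⟨T, hT, hm⟩ := h₂ u v h
    exacts [⟨T, .inl ⟨hT, hm⟩⟩, ⟨T, .inr ⟨hT, hm⟩⟩]
  eq_of_mem h h' hv hv' := (h₃ _ _ h _ hv).1 _ h' hv'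
  asymm h hv h' := (h₃ _ _ h _ hv).2 _ h'

end TripleSystem

/-! ### Systems with balanced colourings -/

/-- A triple system of order divisible by `3` with a proper colouring `f` whose colour classes
have at most `(2 n - s) / 3` vertices. -/
structure ColouredSystem (s : ℕ) (C : Type) [DecidableEq C] where
  V : Type
  [fintype : Fintype V]
  S : TripleSystem V
  f : V → C
  proper : S.Proper f
  three_dvd : 3 ∣ Fintype.card V
  balanced : ∀ c, 3 * (univ.filter (f · = c)).card + s ≤ 2 * Fintype.card V

namespace ColouredSystem

attribute [instance] ColouredSystem.fintype

variable {s t : ℕ} {C D : Type} [DecidableEq C] [DecidableEq D]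

/-- Gluing of coloured systems. -/
@[simps V S f]
def glue (X : ColouredSystem s C) (Y : ColouredSystem t C) {Q : Set (Finset X.V)}
    (hQ : IsTriplePartition univ Q) (hQf : ∀ T ∈ Q, NonMono X.f T) : ColouredSystem (s + t) C where
  V := X.V ⊕ Y.V
  S := X.S.glue Y.S hQ
  f := Sum.elim X.f Y.f
  proper := X.proper.glue Y.proper hQf
  three_dvd := by
    rw [Fintype.card_sum]
    exact dvd_add X.three_dvd Y.three_dvd
  balanced c := by
    have hX := X.balanced c
    have hY := Y.balanced c
    rw [card_filter] at hX hY ⊢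
    rw [Fintype.sum_sum_type, Fintype.card_sum]
    change 3 * ((∑ v, if X.f v = c then 1 else 0) + ∑ v, if Y.f v = c then 1 else 0) + _ ≤ _
    omega

/-- Weakening of the balance. -/
@[simps V S f]
def weaken (X : ColouredSystem s C) (h : t ≤ s) : ColouredSystem t C where
  V := X.V
  S := X.S
  f := X.f
  proper := X.proper
  three_dvd := X.three_dvd
  balanced c := by have := X.balanced c; omega

/-- Renaming of the colours. -/
@[simps V S f]
def recolour (X : ColouredSystem s C) (i : C ↪ D) (c₀ : C) : ColouredSystem s D where
  V := X.V
  S := X.S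
  f := i ∘ X.f
  proper := X.proper.comp_injective i.injective
  three_dvd := X.three_dvd
  balanced d := by
    by_cases h : ∃ c, i c = d
    · obtain ⟨c, rfl⟩ := h
      simpa using X.balanced c
    · have : (univ.filter fun v => (i ∘ X.f) v = d) = ∅ := by
        ext v
        simpa using fun hv => h ⟨_, hv⟩
      rw [this]
      have := X.balanced c₀
      simp
      omega

theorem exists_partition [LinearOrder C] (X : ColouredSystem s C) :
    ∃ Q, IsTriplePartition (univ : Finset X.V) Q ∧ ∀ T ∈ Q, NonMono X.f T :=
  exists_nonMono_triplePartition X.f univ X.three_dvd fun c => by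
    have := X.balanced c
    rw [card_univ]
    convert (by omega : 3 * (univ.filter (X.f · = c)).card ≤ 2 * Fintype.card X.V)

theorem exists_partition_mem [LinearOrder C] (X : ColouredSystem 6 C) {T : Finset X.V}
    (hT : T.card = 3) (hf : NonMono X.f T) :
    ∃ Q, IsTriplePartition (univ : Finset X.V) Q ∧ (∀ T ∈ Q, NonMono X.f T) ∧ T ∈ Q :=
  exists_nonMono_triplePartition_mem X.f univ T X.three_dvd (fun c => by
    rw [card_univ]
    convert X.balanced c) hT (subset_univ _) hf

/-! ### Small orders -/

/-- A system of order `6`. -/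
def six : ColouredSystem 3 (Fin 2) where
  V := Fin 6
  -- Vertices 0 to 4 form the cyclic tournament `i → i+1, i+2` mod 5, and each also takes the edge
  -- to 5.
  S := .ofFinsets (fun v => match v with
    | 0 => {{1, 2, 5}}
    | 1 => {{2, 3, 5}}
    | 2 => {{3, 4, 5}}
    | 3 => {{4, 0, 5}}
    | 4 => {{0, 1, 5}}
    | 5 => ∅) (by decide +kernel) (by decide +kernel) (by decide +kernel)
  f := ![0, 0, 1, 1, 1, 0]
  proper := by
    change ∀ v, ∀ T ∈ _, _
    decide +kernel
  three_dvd := by decide +kernel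
  balanced := by decide +kernel

/-- A system of order `9`. -/
def nine : ColouredSystem 0 (Fin 2) where
  V := Fin 9
  S := .ofFinsets (fun v => match v with
    | 0 => {{1, 2, 7}}
    | 1 => {{2, 3, 6}}
    | 2 => {{3, 4, 8}}
    | 3 => {{0, 4, 7}}
    | 4 => {{0, 1, 6}}
    | 5 => {{0, 1, 2}, {3, 4, 7}}
    | 6 => {{0, 2, 5}, {3, 7, 8}}
    | 7 => {{1, 2, 4}}
    | 8 => {{0, 1, 3}, {4, 5, 7}}) (by decide +kernel) (by decide +kernel) (by decide +kernel)
  f := ![0, 0, 0, 0, 0, 1, 1, 1, 1]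
  proper := by
    change ∀ v, ∀ T ∈ _, _
    decide +kernel
  three_dvd := by decide +kernel
  balanced := by decide +kernel

theorem exists_card_eq (m : ℕ) (hm : 2 ≤ m) :
    ∃ X : ColouredSystem 0 (Fin 2), Fintype.card X.V = 3 * m := by
  induction m using Nat.strong_induction_on with
  | _ m ih =>
    obtain rfl | rfl | h : m = 2 ∨ m = 3 ∨ 4 ≤ m := by omega
    · exact ⟨six.weaken (by omega), rfl⟩
    · exact ⟨nine, rfl⟩
    · obtain ⟨X, hX⟩ := ih (m - 2) (by omega) (by omega)
      obtain ⟨Q, hQ, hQf⟩ := X.exists_partition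
      refine ⟨X.glue (six.weaken (Nat.zero_le _)) hQ hQf, ?_⟩
      simp only [glue_V, weaken_V]
      rw [Fintype.card_sum, hX]
      change _ + Fintype.card (Fin 6) = _
      rw [Fintype.card_fin]
      omega

end ColouredSystem

/-! ### Raising the chromatic number -/

/-- A system with a balanced proper colouring in `j + 1` colours and no proper colouring in `j`
colours. -/
def HasChromaticSystem (j : ℕ) : Prop :=
  ∃ X : ColouredSystem 6 (Fin (j + 1)), ∀ g : X.V → Fin j, ¬ X.S.Proper g

/-- A missed colour could be deleted, leaving a proper `j`-colouring. -/
theorem TripleSystem.Proper.surjective {V : Type*} {j : ℕ} {S : TripleSystem V}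
    (hS : ∀ g : V → Fin j, ¬ S.Proper g) {g : V → Fin (j + 1)} (hg : S.Proper g) :
    Function.Surjective g := by
  intro c
  by_contra! hc
  choose g' hg' using fun v => Fin.exists_succAbove_eq (hc v)
  obtain rfl : c.succAbove ∘ g' = g := funext hg'
  exact hS g' hg.of_comp

namespace ColouredSystem

variable {j : ℕ}

/-- The `t`-th added copy of `X` is recoloured to avoid `c t`, while every proper `g` must use
colour 0 somewhere on it. -/
theorem exists_injective_zero (X : ColouredSystem 6 (Fin (j + 1)))
    (hX : ∀ g : X.V → Fin j, ¬ X.S.Proper g) (c : ℕ → Fin (j + 2)) (i : ℕ) :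
    ∃ W : ColouredSystem 6 (Fin (j + 2)), ∀ g : W.V → Fin (j + 1), W.S.Proper g →
      ∃ x : Fin i → W.V, Function.Injective x ∧ ∀ t, g (x t) = 0 ∧ W.f (x t) ≠ c t := by
  induction i with
  | zero =>
    exact ⟨X.recolour Fin.castSuccEmb 0, fun g _ =>
      ⟨Fin.elim0, fun a => a.elim0, fun a => a.elim0⟩⟩
  | succ i ih =>
    obtain ⟨W, hW⟩ := ih
    obtain ⟨Q, hQ, hQf⟩ := W.exists_partition
    refine ⟨(W.glue (X.recolour (c i).succAboveEmb 0) hQ hQf).weaken (by omega), ?_⟩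
    intro g hg
    simp only [weaken_S, glue_S] at hg
    obtain ⟨x, hx, hxt⟩ := hW _ hg.glue_left
    obtain ⟨b, hb⟩ := TripleSystem.Proper.surjective hX hg.glue_right 0
    refine ⟨Fin.snoc (α := fun _ => W.V ⊕ X.V) (Sum.inl ∘ x) (Sum.inr b), ?_, ?_⟩
    · exact Fin.snoc_injective_iff.2 ⟨Sum.inl_injective.comp hx, by rintro ⟨_, h⟩; cases h⟩
    · intro t
      induction t using Fin.lastCases with
      | last =>
        rw [Fin.snoc_last]
        exact ⟨hb, Fin.succAbove_ne _ _⟩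
      | cast t =>
        rw [Fin.snoc_castSucc]
        exact hxt t

theorem exists_mono_nonMono (hj : 1 ≤ j) (X : ColouredSystem 6 (Fin (j + 1)))
    (hX : ∀ g : X.V → Fin j, ¬ X.S.Proper g) :
    ∃ W : ColouredSystem 6 (Fin (j + 2)), ∀ g : W.V → Fin (j + 1), W.S.Proper g →
      ∃ T : Finset W.V, T.card = 3 ∧ NonMono W.f T ∧ ¬ NonMono g T := by
  classical
  obtain ⟨W, hW⟩ := X.exists_injective_zero hX (Fin.ofNat (j + 2)) (j + 2)
  refine ⟨W, fun g hg => ?_⟩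
  obtain ⟨x, hx, hxt⟩ := hW g hg
  have hne : ∀ t, W.f (x t) ≠ t := fun t => by simpa using (hxt t).2
  -- The third index needs `j + 2 ≥ 3`; it only brings the triple to size three.
  obtain ⟨r, hr⟩ : ∃ r : Fin (j + 2), r ∉ ({0, W.f (x 0)} : Finset (Fin (j + 2))) := by
    by_contra! h
    have h1 := card_le_card (fun r _ => h r : univ ⊆ _)
    have h2 := card_le_two (a := 0) (b := W.f (x 0))
    simp at h1
    omega
  simp only [mem_insert, mem_singleton, not_or] at hr
  -- The vertex indexed by the colour of `x 0` avoids that colour, so `W.f` separates these two,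
  -- while `g` is 0 on all three.
  refine ⟨{x 0, x (W.f (x 0)), x r}, ?_, ⟨x 0, by simp, x (W.f (x 0)), by simp, (hne _).symm⟩, ?_⟩
  · rw [card_eq_three]
    exact ⟨_, _, _, hx.ne (hne 0).symm, hx.ne (Ne.symm hr.1), hx.ne (Ne.symm hr.2), rfl⟩
  · rintro ⟨y, hy, z, hz, hyz⟩
    have : ∀ y ∈ ({x 0, x (W.f (x 0)), x r} : Finset W.V), g y = 0 := by
      intro y hy
      simp only [mem_insert, mem_singleton] at hy
      obtain rfl | rfl | rfl := hy <;> exact (hxt _).1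
    exact hyz ((this y hy).trans (this z hz).symm)

/-- One copy of `X` per triple: it contains every colour of `g`, so a triple monochromatic under `g`
would form a monochromatic star with one of its vertices. -/
theorem exists_extension (X : ColouredSystem 6 (Fin (j + 1)))
    (hX : ∀ g : X.V → Fin j, ¬ X.S.Proper g) (W : ColouredSystem 6 (Fin (j + 2)))
    (𝒯 : Finset (Finset W.V)) (h𝒯 : ∀ T ∈ 𝒯, T.card = 3 ∧ NonMono W.f T) :
    ∃ (U : ColouredSystem 6 (Fin (j + 2))) (i : W.V ↪ U.V), U.f ∘ i = W.f ∧
      ∀ g : U.V → Fin (j + 1), U.S.Proper g →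
        W.S.Proper (g ∘ i) ∧ ∀ T ∈ 𝒯, NonMono (g ∘ i) T := by
  classical
  induction 𝒯 using Finset.induction with
  | empty => exact ⟨W, .refl _, rfl, fun g hg => ⟨hg, by simp⟩⟩
  | insert T 𝒯 hT ih =>
    obtain ⟨U, i, hi, hU⟩ := ih fun T h => h𝒯 T (mem_insert_of_mem h)
    obtain ⟨hT3, y, hy, z, hz, hyz⟩ := h𝒯 T (mem_insert_self _ _)
    obtain ⟨Q, hQ, hQf, hTQ⟩ := U.exists_partition_mem (T := T.map i) (by simpa using hT3)
      ⟨i y, mem_map_of_mem _ hy, i z, mem_map_of_mem _ hz, by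
        rwa [← hi] at hyz⟩
    refine ⟨(U.glue (X.recolour Fin.castSuccEmb 0) hQ hQf).weaken (by omega),
      i.trans .inl, hi, fun g hg => ?_⟩
    simp only [weaken_S, glue_S] at hg
    obtain ⟨h1, h2⟩ := hU _ hg.glue_left
    refine ⟨h1, fun T' hT' => ?_⟩
    obtain rfl | hT' := mem_insert.1 hT'
    · obtain ⟨b, hb⟩ := TripleSystem.Proper.surjective hX hg.glue_right (g (.inl (i y)))
      obtain ⟨w, hw, hne⟩ := hg.glue_mem hTQ b
      obtain ⟨x, hx, rfl⟩ := mem_map.1 hw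
      exact ⟨x, hx, y, hy, fun h => hne (h.trans hb.symm)⟩
    · exact h2 T' hT'

end ColouredSystem

theorem HasChromaticSystem.succ {j : ℕ} (hj : 1 ≤ j) (h : HasChromaticSystem j) :
    HasChromaticSystem (j + 1) := by
  classical
  obtain ⟨X, hX⟩ := h
  obtain ⟨W, hW⟩ := X.exists_mono_nonMono hj hX
  obtain ⟨U, i, -, hU⟩ := X.exists_extension hX W
    (univ.filter fun T => T.card = 3 ∧ NonMono W.f T) (by simp)
  refine ⟨U, fun g hg => ?_⟩
  obtain ⟨h1, h2⟩ := hU g hg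
  obtain ⟨T, hT, hTf, hTg⟩ := hW _ h1
  exact hTg (h2 T (by simp [hT, hTf]))

theorem hasChromaticSystem_one : HasChromaticSystem 1 := by
  obtain ⟨Q, hQ, hQf⟩ := ColouredSystem.six.exists_partition
  refine ⟨ColouredSystem.six.glue ColouredSystem.six hQ hQf, fun g hg => ?_⟩
  obtain ⟨w, -, hne⟩ := TripleSystem.Proper.glue_left (hQ := hQ) hg (0 : Fin 6)
    ({1, 2, 5} : Finset (Fin 6)) (mem_singleton_self _)
  exact hne (Subsingleton.elim _ _)

theorem hasChromaticSystem {j : ℕ} (hj : 1 ≤ j) : HasChromaticSystem j := by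
  induction j, hj using Nat.le_induction with
  | base => exact hasChromaticSystem_one
  | succ j hj ih => exact ih.succ hj

/-! ### All large orders -/

/-- A system of order `3 m` extends to systems of all orders `n ≥ 3 m + 6` with
`n ≡ 0, 1 (mod 3)`. -/
theorem ColouredSystem.exists_isColourable {j : ℕ} (hj : 1 ≤ j)
    (X : ColouredSystem 0 (Fin (j + 1))) {n : ℕ} (hn : Fintype.card X.V + 6 ≤ n)
    (h : n % 3 = 0 ∨ n % 3 = 1) :
    ∃ B : StarSystem 3 (Fin n), B.IsColourable (j + 1) ∧
      ((∀ g : X.V → Fin j, ¬ X.S.Proper g) → ¬ B.IsColourable j) := by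
  obtain ⟨m, hm⟩ := X.three_dvd
  obtain ⟨Y, hY⟩ := exists_card_eq (n / 3 - m) (by omega)
  obtain ⟨Q, hQ, hQf⟩ := X.exists_partition
  let Z : ColouredSystem 0 (Fin (j + 1)) := X.glue (Y.recolour (Fin.castLEEmb (by omega)) 0) hQ hQf
  have hZ : Fintype.card Z.V = 3 * (n / 3) := by
    change Fintype.card (X.V ⊕ Y.V) = _
    rw [Fintype.card_sum]
    omega
  have hXZ : (∀ g : X.V → Fin j, ¬ X.S.Proper g) → ∀ g : Z.V → Fin j, ¬ Z.S.Proper g :=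
    fun h g hg => h _ (TripleSystem.Proper.glue_left (hQ := hQ) hg)
  rcases h with h | h
  · let e : Z.V ≃ Fin n := Fintype.equivFinOfCardEq (by omega)
    refine ⟨(Z.S.mapEquiv e).toStarSystem, ?_, fun hc => ?_⟩ <;>
      rw [TripleSystem.isColourable_toStarSystem_iff]
    · exact ⟨_, Z.proper.mapEquiv e⟩
    · rintro ⟨g, hg⟩
      exact hXZ hc _ hg.of_mapEquiv
  · obtain ⟨Q', hQ', hQf'⟩ := Z.exists_partition
    let e : Z.V ⊕ Unit ≃ Fin n := Fintype.equivFinOfCardEq (by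
      rw [Fintype.card_sum, Fintype.card_unit]
      omega)
    refine ⟨((Z.S.glue .single hQ').mapEquiv e).toStarSystem, ?_, fun hc => ?_⟩ <;>
      rw [TripleSystem.isColourable_toStarSystem_iff]
    · exact ⟨_, (Z.proper.glue (TripleSystem.proper_single fun _ => 0) hQf').mapEquiv e⟩
    · rintro ⟨g, hg⟩
      exact hXZ hc _ hg.of_mapEquiv.glue_left

/-! ### Necessary conditions on the order -/

namespace StarSystem

theorem three_dvd_choose_two {n : ℕ} (B : StarSystem 3 (Fin n)) : 3 ∣ n.choose 2 := by
  classical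
  have : Finite (GraphStar 3 (Fin n)) :=
    Finite.of_injective (fun S : GraphStar 3 (Fin n) => (S.centre, S.leaves)) fun S T h => by
      cases S; cases T; simpa using h
  have := Fintype.ofFinite (GraphStar 3 (Fin n))
  let E : GraphStar 3 (Fin n) → Finset (Sym2 (Fin n)) :=
    fun S => S.leaves.image fun a => s(S.centre, a)
  have hE : ∀ S p, p ∈ E S ↔ p ∈ S.edges := fun S p => by
    simp [E, GraphStar.edges, eq_comm]
  have hcard : ∀ S, (E S).card = 3 := fun S => by
    rw [card_image_of_injective _ fun a b h => Sym2.congr_right.1 h, S.card_leaves]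
  have hsub : ∀ S, ∀ p ∈ E S, p ∈ (⊤ : SimpleGraph (Fin n)).edgeSet := by
    intro S p hp
    obtain ⟨a, ha, rfl⟩ := mem_image.1 hp
    simpa using fun h : S.centre = a => S.centre_notMem (h ▸ ha)
  have key : (⊤ : SimpleGraph (Fin n)).edgeFinset = (univ.filter (· ∈ B.blocks)).biUnion E := by
    ext p
    rw [SimpleGraph.mem_edgeFinset, mem_biUnion]
    constructor
    · intro hp
      obtain ⟨S, ⟨hS, hpS⟩, -⟩ := B.existsUnique_block p hp
      exact ⟨S, by simpa using hS, (hE S p).2 hpS⟩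
    · rintro ⟨S, -, hp⟩
      exact hsub S p hp
  have h := SimpleGraph.card_edgeFinset_top_eq_card_choose_two (V := Fin n)
  rw [key, card_biUnion, sum_const_nat fun S _ => hcard S, Fintype.card_fin] at h
  · exact ⟨_, h.symm.trans (mul_comm _ _)⟩
  · intro S hS T hT hne
    refine Finset.disjoint_left.2 fun p hpS hpT => ?_
    exact hne ((B.existsUnique_block p (hsub S p hpS)).unique
      ⟨by simpa using hS, (hE S p).1 hpS⟩ ⟨by simpa using hT, (hE T p).1 hpT⟩)

/-- With at most four vertices every star spans all of them, so two stars with distinct centres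
share the edge between the centres; yet an edge between two leaves of one star lies in a star
centred elsewhere. -/
theorem four_lt {n : ℕ} (hn : 1 < n) (B : StarSystem 3 (Fin n)) : 4 < n := by
  by_contra! h4
  have hmem : ∀ (S : GraphStar 3 (Fin n)) a, a ≠ S.centre → a ∈ S.leaves := by
    intro S a ha
    by_contra hm
    have := card_le_univ (insert a (insert S.centre S.leaves))
    rw [card_insert_of_notMem (by simp [ha, hm]), card_insert_of_notMem S.centre_notMem,
      S.card_leaves, Fintype.card_fin] at this
    omega
  have hblock : ∀ u v : Fin n, u ≠ v → ∃ S ∈ B.blocks, S.centre = u ∨ S.centre = v := by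
    intro u v huv
    obtain ⟨S, ⟨hS, a, -, hp⟩, -⟩ := B.existsUnique_block s(u, v) (by simpa using huv)
    rcases Sym2.eq_iff.1 hp with ⟨h, -⟩ | ⟨-, h⟩
    exacts [⟨S, hS, .inl h.symm⟩, ⟨S, hS, .inr h.symm⟩]
  obtain ⟨S, hS, -⟩ := hblock ⟨0, by omega⟩ ⟨1, by omega⟩ (by simp)
  obtain ⟨u, hu, v, hv, huv⟩ := one_lt_card.1 (by rw [S.card_leaves]; omega : 1 < S.leaves.card)
  obtain ⟨T, hT, hc⟩ := hblock u v huv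
  have hne : T.centre ≠ S.centre := by
    rintro h
    rcases hc with hc | hc
    · exact S.centre_notMem (by rwa [← h, hc])
    · exact S.centre_notMem (by rwa [← h, hc])
  have := (B.existsUnique_block s(S.centre, T.centre) (by simpa using hne.symm)).unique
    ⟨hS, T.centre, hmem S _ hne, rfl⟩ ⟨hT, S.centre, hmem T _ hne.symm, Sym2.eq_swap⟩
  exact hne (by rw [this])

end StarSystem

theorem isAdmissibleOrder_three_iff (n : ℕ) :
    IsAdmissibleOrder 3 n ↔ (n ≡ 0 [MOD 3] ∨ n ≡ 1 [MOD 3]) ∧ 6 ≤ n := by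
  simp only [Nat.ModEq]
  constructor
  · rintro ⟨hn, ⟨B⟩⟩
    have h4 := B.four_lt hn
    have h3 : 3 ∣ n * (n - 1) := by
      rw [← Nat.div_mul_cancel (Nat.two_dvd_mul_sub_one n), ← Nat.choose_two_right]
      exact B.three_dvd_choose_two.mul_right 2
    rcases (Nat.Prime.dvd_mul Nat.prime_three).1 h3 with h | h <;> omega
  · rintro ⟨h, hn⟩
    refine ⟨by omega, ?_⟩
    -- Starting from the empty system, the bound on the order becomes `6 ≤ n`.
    obtain ⟨B, -⟩ := ColouredSystem.exists_isColourable le_rfl (n := n)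
      ⟨Empty, ⟨fun _ _ => False, False.elim, False.elim, fun {u} => u.elim, False.elim, False.elim⟩,
        Empty.elim, fun v => v.elim, by simp, by simp⟩ (by simpa using hn) (by simpa using h)
    exact ⟨B⟩

theorem mainTheorem2 :
    (∀ n : ℕ, IsAdmissibleOrder 3 n ↔ (n ≡ 0 [MOD 3] ∨ n ≡ 1 [MOD 3]) ∧ 6 ≤ n) ∧
    ∀ k : ℕ, 2 ≤ k → ∃ n_k : ℕ, ∀ n : ℕ, n_k ≤ n → IsAdmissibleOrder 3 n →
      ∃ B : StarSystem 3 (Fin n), B.IsChromatic k := by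
  refine ⟨isAdmissibleOrder_three_iff, fun k hk => ?_⟩
  obtain ⟨j, rfl⟩ : ∃ j, k = j + 1 := ⟨k - 1, by omega⟩
  obtain ⟨X, hX⟩ := hasChromaticSystem (by omega : 1 ≤ j)
  refine ⟨Fintype.card X.V + 6, fun n hn hadm => ?_⟩
  obtain ⟨h, -⟩ := (isAdmissibleOrder_three_iff n).1 hadm
  obtain ⟨B, h1, h2⟩ := (X.weaken (Nat.zero_le 6)).exists_isColourable (by omega) hn h
  exact ⟨B, h1, h2 hX⟩
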